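/- Let $p$ be an odd prime, let $1\le s<m$ be integers, and put $q=p^m$ and $q_0=p^{\gcd(m,s)}$. Let $\beta\in\mathbb F_{q^2}$ have multiplicative order $q+1$, so that $\mathcal U_{q+1}=\{u\in\mathbb F_{q^2}^*:u^{q+1}=1\}=\{\beta^{-i}:0\le i\le q\}$, and let $C_s=C\left(\frac{p^s-1}2,\frac{p^s+1}2\right)$ be the code of length $q+1$ over $\mathbb F_q$ consisting of the words $$c(a,b)=\left(\operatorname{Tr}_{q^2/q}\left(a\beta^{-\frac{p^s-1}{2}i}+b\beta^{-\frac{p^s+1}{2}i}\right)\right)_{i=0}^{q},\qquad a,b\in\mathbb F_{q^2}.$$ Write $\operatorname{PG}(1,q)=\mathbb F_q\cup\{\infty\}$; an $\mathbb F_{q_0}$-subline is a set $L(\mathbb F_{q_0}\cup\{\infty\})$ with $L\in\operatorname{PGL}(2,q)$ acting by fractional linear transformations. Let $\varepsilon\in\mathbb F_{q^2}^*$ satisfy $\varepsilon^q=-\varepsilon$, and let $\vartheta_\varepsilon(x)=\frac{x+\varepsilon}{x-\varepsilon}$ for $x\in\mathbb F_q$, $\vartheta_\varepsilon(\infty)=1$.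 For a word $c=(c_0,\dots,c_q)$ put $Z(c)=\{\beta^{-i}:c_i=0\}$. Then: 1. $C_s$ is the cyclic code of length $q+1$ over $\mathbb F_q$ whose check polynomial is the product of the minimal polynomials over $\mathbb F_q$ of $\beta^{(p^s-1)/2}$ and $\beta^{(p^s+1)/2}$. 2. The minimum weight of $C_s$ is $q-q_0$, and the zero sets of its minimum-weight codewords are exactly the Cayley images of the sublines: $$\{Z(c):c\in C_s,\ \operatorname{wt}(c)=q-q_0\}=\{\vartheta_\varepsilon(B):B\text{ an }\mathbb F_{q_0}\text{-subline of }\operatorname{PG}(1,q)\}.$$ 3. The points of $\operatorname{PG}(1,q)$ together with its $\mathbb F_{q_0}$-sublines as blocks form a Steiner system $S(3,q_0+1,q+1)$ (there are $q+1$ points, every block has $q_0+1$ points, and any three distinct points lie in exactly one block). The map $i\mapsto\vartheta_\varepsilon^{-1}(\beta^{-i})$ is a well-defined bijection from the coordinate set $\{0,\dots,q\}$ onto $\operatorname{PG}(1,q)$, and it is an isomorphism from the incidence structure of the supports of the minimum-weight codewords of $C_s$ onto the complement of this Steiner system, that is, the structure with point set $\operatorname{PG}(1,q)$ whose blocks are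 the sets $\operatorname{PG}(1,q)\setminus B$ with $B$ an $\mathbb F_{q_0}$-subline. -/

import Mathlib

open scoped Polynomial MatrixGroups

namespace CyclicSubline

/-! ### Linear codes of length `n` -/

section Codes

variable {F : Type*} [Field F] {n : ℕ}

/-- The minimum weight of a linear code: the least Hamming weight of a nonzero codeword
(it equals the minimum distance). -/
noncomputable def minWeight [DecidableEq F] (C : Submodule F (Fin n → F)) : ℕ :=
  sInf {w : ℕ | ∃ c ∈ C, c ≠ 0 ∧ hammingNorm c = w}

/-- `c` is a nonzero codeword of `C` of minimum weight. -/
def IsMinWord [DecidableEq F] (C : Submodule F (Fin n → F)) (c : Fin n → F) : Prop :=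
  c ∈ C ∧ c ≠ 0 ∧ hammingNorm c = minWeight C

/-- `C` is the cyclic code of length `n` with check polynomial `h`: here `h` divides `X ^ n - 1`,
and a word `(c_0, …, c_{n-1})`, viewed as the polynomial `c_0 + c_1 X + ⋯ + c_{n-1} X ^ (n-1)`,
lies in `C` iff its product with `h` vanishes modulo `X ^ n - 1`. -/
def IsCyclicCodeWithCheck (C : Submodule F (Fin n → F)) (h : F[X]) : Prop :=
  h ∣ Polynomial.X ^ n - 1 ∧
    ∀ c : Fin n → F, c ∈ C ↔
      (Polynomial.X ^ n - 1 : F[X]) ∣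
        (∑ i : Fin n, Polynomial.C (c i) * Polynomial.X ^ (i : ℕ)) * h

end Codes

/-! ### The codes `C(e, f)` in their trace representation -/

section TraceCode

variable (F : Type*) {E : Type*} [Field F] [Field E] [Algebra F E]

/-- The code of length `n` over `F` of all words
`(Tr_{E/F} (a β^{-e i} + b β^{-f i}))_{0 ≤ i < n}` with `a, b ∈ E`. -/
noncomputable def traceCode (n : ℕ) (β : E) (e f : ℕ) : Submodule F (Fin n → F) :=
  LinearMap.range (LinearMap.pi fun i : Fin n =>
    (Algebra.trace F E).comp
      ((LinearMap.mulRight F (β⁻¹ ^ (e * (i : ℕ)))).coprod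
        (LinearMap.mulRight F (β⁻¹ ^ (f * (i : ℕ))))))

/-- Membership in `traceCode`, spelled out. -/
theorem mem_traceCode {n : ℕ} {β : E} {e f : ℕ} {c : Fin n → F} :
    c ∈ traceCode F n β e f ↔ ∃ a b : E, ∀ i : Fin n,
      c i = Algebra.trace F E (a * β⁻¹ ^ (e * (i : ℕ)) + b * β⁻¹ ^ (f * (i : ℕ))) := by
  simp only [traceCode, LinearMap.mem_range, Prod.exists, funext_iff]
  simp [eq_comm]

variable {F}

/-- The zero set of a word, with the coordinate `i` read as the point `β^{-i}`. -/
def zeroSet {n : ℕ} (β : E) (c : Fin n → F) : Set E :=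
  {u | ∃ i : Fin n, u = β⁻¹ ^ (i : ℕ) ∧ c i = 0}

end TraceCode

/-! ### The projective line `PG(1, F) = F ∪ {∞}`, its sublines, and Cayley coordinates -/

section ProjectiveLine

variable {F : Type*} [Field F]

/-- `B` is a `K₀`-subline of `PG(1, F)`: the image of `PG(1, K₀) = K₀ ∪ {∞}` under a fractional
linear transformation with coefficients in `F`. -/
def IsSubline [DecidableEq F] (K₀ : Subfield F) (B : Set (OnePoint F)) : Prop :=
  ∃ L : GL (Fin 2) F, B = (fun x => L • x) '' Set.range (OnePoint.map (K₀.subtype : K₀ → F))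

/-- The Cayley map `x ↦ (x + ε) / (x - ε)`, `∞ ↦ 1`. -/
noncomputable def cayley {E : Type*} [Field E] [Algebra F E] (ε : E) (x : OnePoint F) : E :=
  x.elim 1 fun t => (algebraMap F E t + ε) / (algebraMap F E t - ε)

end ProjectiveLine

/-! ### Incidence structures -/

/-- An incidence structure on the point set `V`, given by its set of blocks. -/
structure IncidenceStructure (V : Type*) where
  blocks : Set (Set V)

namespace IncidenceStructure

variable {V W : Type*}

/-- The complementary structure, with blocks `V \ B`. -/
def complement (D : IncidenceStructure V) : IncidenceStructure V where
  blocks := {A | ∃ B ∈ D.blocks, A = Bᶜ}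

/-- The bijection `φ` of the point sets is an isomorphism of incidence structures. -/
def IsIso (D : IncidenceStructure V) (D' : IncidenceStructure W) (φ : V ≃ W) : Prop :=
  ∀ B : Set V, B ∈ D.blocks ↔ φ '' B ∈ D'.blocks

/-- `D` is a Steiner system `S(t, k, v)`. -/
def IsSteinerSystem (D : IncidenceStructure V) (t k v : ℕ) : Prop :=
  Nat.card V = v ∧ (∀ B ∈ D.blocks, B.ncard = k) ∧
    ∀ T : Set V, T.ncard = t → ∃! B : Set V, B ∈ D.blocks ∧ T ⊆ B

end IncidenceStructure

/-- The incidence structure of the supports of the minimum-weight codewords, on the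
coordinate set. -/
def minSupportDesign {F : Type*} [Field F] [DecidableEq F] {n : ℕ}
    (C : Submodule F (Fin n → F)) : IncidenceStructure (Fin n) where
  blocks := {S | ∃ c, IsMinWord C c ∧ S = Function.support c}

/-- The incidence structure of the points and the `K₀`-sublines of `PG(1, F)`. -/
def sublineDesign {F : Type*} [Field F] [DecidableEq F] (K₀ : Subfield F) :
    IncidenceStructure (OnePoint F) where
  blocks := {B | IsSubline K₀ B}

end CyclicSubline

/-!
Multiplied by a power of the root of unity `u`, the coordinate of the word with parameters `a`, `b`
at `u` is `b u ^ (P + 1) + a u ^ P + a ^ q u + b ^ q`, where `P = p ^ s`. Under the Cayley map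
`u = (x + ε) / (x - ε)` this becomes, up to a nonzero factor, the value at the point `x` of
`PG(1, F)` of a form `A x ^ (P + 1) + B x ^ P + C x + D` with coefficients in `F`, that is, of a
form on `F ^ 2` sesquilinear for the automorphism `σ : x ↦ x ^ P`
(`trace_eq_zero_iff_mem_isotropicPoints`); every matrix of coefficients occurs
(`exists_wordForm_eq`). So the zero sets of the codewords are exactly the sets of isotropic points
of `σ`-sesquilinear forms.

The group `GL(2, F)` acts on these forms and is triply transitive on the points. A nonzero form with
three isotropic points may therefore be assumed to vanish at `∞`, `0` and `1`; then it is a multiple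
of `x ^ P - x`, and its isotropic points form the line over the fixed field of `σ`, which is the
subfield with `q₀ = p ^ gcd(m, s)` elements. Hence a nonzero form has at most two isotropic points
or its isotropic points form a subline, and every subline arises in this way
(`isSubline_isotropicPoints`, `IsSubline.exists_isotropicPoints_eq`). Since `q₀ + 1 > 2`, this gives
the minimum weight and the words attaining it (`minWeight_and_isSubline_iff`). The same
normalization shows that three points lie on a unique subline (`existsUnique_isSubline`).

That the code is cyclic with the stated check polynomial is Fourier inversion on the group of
`(q + 1)`-st roots of unity: both membership in the code and divisibility by `X ^ (q + 1) - 1` say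
that the Fourier transform of the word is supported on the roots of the check polynomial
(`exists_trace_iff_evalWord`, `X_pow_sub_one_dvd_iff`).
-/

namespace CyclicSubline

/-! ### Sesquilinear forms on `F ^ 2` and their isotropic points -/

section Forms

open Matrix

variable {F : Type*} [Field F]

/-- Homogeneous coordinates of a point of `PG(1, F)`: `(1, 0)` for `∞` and `(t, 1)` for `t`. -/
def coords (x : OnePoint F) : Fin 2 → F :=
  x.elim ![1, 0] fun t => ![t, 1]

@[simp] lemma coords_infty : coords (OnePoint.infty : OnePoint F) = ![1, 0] := rfl

@[simp] lemma coords_coe (t : F) : coords (t : OnePoint F) = ![t, 1] := rfl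

/-- The value `σ(v)ᵀ M v` of the `σ`-sesquilinear form with matrix `M`, where `σ` acts on
coordinates. -/
def semiForm (σ : F →+* F) (M : Matrix (Fin 2) (Fin 2) F) (v : Fin 2 → F) : F :=
  (fun i => σ (v i)) ⬝ᵥ (M *ᵥ v)

lemma semiForm_apply (σ : F →+* F) (M : Matrix (Fin 2) (Fin 2) F) (v : Fin 2 → F) :
    semiForm σ M v = σ (v 0) * (M 0 0 * v 0 + M 0 1 * v 1) +
      σ (v 1) * (M 1 0 * v 0 + M 1 1 * v 1) := by
  simp [semiForm, dotProduct, Fin.sum_univ_two]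

/-- The points of `PG(1, F)` at which the `σ`-sesquilinear form with matrix `M` vanishes. -/
def isotropicPoints (σ : F →+* F) (M : Matrix (Fin 2) (Fin 2) F) : Set (OnePoint F) :=
  {x | semiForm σ M (coords x) = 0}

lemma semiForm_smul (σ : F →+* F) (M : Matrix (Fin 2) (Fin 2) F) (c : F) (v : Fin 2 → F) :
    semiForm σ M (c • v) = σ c * c * semiForm σ M v := by
  simp only [semiForm_apply, Pi.smul_apply, smul_eq_mul, map_mul]
  ring

lemma semiForm_mulVec (σ : F →+* F) (M g : Matrix (Fin 2) (Fin 2) F) (v : Fin 2 → F) :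
    semiForm σ M (g *ᵥ v) = semiForm σ ((g.map σ)ᵀ * M * g) v := by
  simp only [semiForm_apply, mulVec_fin_two, Matrix.mul_apply, Fin.sum_univ_two, map_mul, map_add,
    transpose_apply, map_apply, cons_val_zero, cons_val_one]
  ring

lemma transform_ne_zero (σ : F →+* F) {M : Matrix (Fin 2) (Fin 2) F} (hM : M ≠ 0)
    (g : GL (Fin 2) F) :
    ((g : Matrix (Fin 2) (Fin 2) F).map σ)ᵀ * M * (g : Matrix (Fin 2) (Fin 2) F) ≠ 0 := by
  have hg : IsUnit (g : Matrix (Fin 2) (Fin 2) F) := g.isUnit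
  have hgσ : IsUnit ((g : Matrix (Fin 2) (Fin 2) F).map σ)ᵀ := by
    rw [isUnit_transpose]
    exact hg.map (RingHom.mapMatrix σ)
  intro h
  rw [hg.mul_left_eq_zero, hgσ.mul_right_eq_zero] at h
  exact hM h

variable [DecidableEq F]

/-- The action of `GL(2, F)` on `PG(1, F)` is the linear action on homogeneous coordinates, up to
scalars. -/
lemma exists_mulVec_coords (g : GL (Fin 2) F) (x : OnePoint F) :
    ∃ c : F, c ≠ 0 ∧ (g : Matrix (Fin 2) (Fin 2) F) *ᵥ coords x = c • coords (g • x) := by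
  have hdet : g 0 0 * g 1 1 - g 0 1 * g 1 0 ≠ 0 := by
    rw [← det_fin_two]; exact g.det_ne_zero
  induction x using OnePoint.rec with
  | infty =>
    rw [OnePoint.smul_infty_eq_ite]
    split_ifs with h
    · refine ⟨g 0 0, fun h0 => hdet (by simp [h, h0]), ?_⟩
      simp [h]
    · refine ⟨g 1 0, h, ?_⟩
      simp [mul_div_cancel₀ _ h]
  | coe t =>
    rw [OnePoint.smul_some_eq_ite]
    split_ifs with h
    · refine ⟨g 0 0 * t + g 0 1, fun h0 => ?_, by simp [h]⟩
      by_cases h1 : g 1 0 = 0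
      · have h2 : g 1 1 = 0 := by simpa [h1] using h
        exact hdet (by simp [h1, h2])
      · refine hdet ?_
        linear_combination g 0 0 * h - g 1 0 * h0
    · refine ⟨g 1 0 * t + g 1 1, h, ?_⟩
      simp [mul_div_cancel₀ _ h]

lemma smul_mem_isotropicPoints_iff (σ : F →+* F) (M : Matrix (Fin 2) (Fin 2) F)
    (g : GL (Fin 2) F) (x : OnePoint F) :
    g • x ∈ isotropicPoints σ M ↔
      x ∈ isotropicPoints σ (((g : Matrix (Fin 2) (Fin 2) F).map σ)ᵀ * M * g) := by
  obtain ⟨c, hc, h⟩ := exists_mulVec_coords g x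
  have h1 := semiForm_mulVec σ M g (coords x)
  rw [h, semiForm_smul] at h1
  have hσ : σ c ≠ 0 := by simpa using hc
  simp only [isotropicPoints, Set.mem_ofPred_eq, ← h1]
  simp [hc, hσ]

/-- The group `GL(2, F)` is triply transitive on `PG(1, F)`. -/
lemma exists_smul_eq_three {x y z : OnePoint F} (hxy : x ≠ y) (hxz : x ≠ z) (hyz : y ≠ z) :
    ∃ L : GL (Fin 2) F, L • (OnePoint.infty : OnePoint F) = x ∧
      L • ((0 : F) : OnePoint F) = y ∧ L • ((1 : F) : OnePoint F) = z := by
  -- the point `x` is moved to `∞` first; the remaining two points are then moved affinely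
  obtain ⟨g, hg⟩ : ∃ g : GL (Fin 2) F, g • (OnePoint.infty : OnePoint F) = x := by
    induction x using OnePoint.rec with
    | infty => exact ⟨1, one_smul _ _⟩
    | coe t =>
      refine ⟨GeneralLinearGroup.mkOfDetNeZero !![t, 1; 1, 0] (by simp), ?_⟩
      rw [OnePoint.smul_infty_eq_ite]
      simp [GeneralLinearGroup.mkOfDetNeZero]
  have key : ∀ w, x ≠ w → ∃ t : F, g • (t : OnePoint F) = w := by
    intro w hw
    have h1 : g⁻¹ • w ≠ OnePoint.infty := fun h => hw (by rw [← hg, ← h, smul_inv_smul])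
    obtain ⟨t, ht⟩ := OnePoint.ne_infty_iff_exists.mp h1
    exact ⟨t, by rw [ht, smul_inv_smul]⟩
  obtain ⟨a, ha⟩ := key y hxy
  obtain ⟨b, hb⟩ := key z hxz
  have hab : b - a ≠ 0 := by
    intro h
    rw [sub_eq_zero] at h
    exact hyz (by rw [← ha, ← hb, h])
  refine ⟨g * GeneralLinearGroup.mkOfDetNeZero !![b - a, a; 0, 1] (by simpa using hab), ?_, ?_, ?_⟩
  · rw [mul_smul, OnePoint.smul_infty_eq_ite]
    simp [GeneralLinearGroup.mkOfDetNeZero, hg]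
  · rw [mul_smul, OnePoint.smul_some_eq_ite]
    simp [GeneralLinearGroup.mkOfDetNeZero, ha]
  · rw [mul_smul, OnePoint.smul_some_eq_ite]
    simp [GeneralLinearGroup.mkOfDetNeZero, hb]

end Forms

/-! ### Sublines as sets of isotropic points -/

section Sublines

open Matrix

variable {F : Type*} [Field F] {σ : F →+* F} {K₀ : Subfield F}

lemma infty_mem_baseLine :
    OnePoint.infty ∈ Set.range (OnePoint.map (K₀.subtype : K₀ → F)) :=
  ⟨OnePoint.infty, rfl⟩

lemma coe_mem_baseLine_iff {t : F} :
    (t : OnePoint F) ∈ Set.range (OnePoint.map (K₀.subtype : K₀ → F)) ↔ t ∈ K₀ := by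
  constructor
  · rintro ⟨x, hx⟩
    induction x using OnePoint.rec with
    | infty => simp at hx
    | coe u =>
      rw [OnePoint.map_some, OnePoint.coe_eq_coe] at hx
      exact hx ▸ u.2
  · exact fun h => ⟨((⟨t, h⟩ : K₀) : OnePoint K₀), rfl⟩

/-- A nonzero form vanishing at `∞`, `0` and `1` is a multiple of `σ(x) y - σ(y) x`, so its isotropic
points form the base subline. -/
lemma isotropicPoints_eq_baseLine (hK₀ : ∀ x, x ∈ K₀ ↔ σ x = x) {M : Matrix (Fin 2) (Fin 2) F}
    (hM : M ≠ 0) (hinf : OnePoint.infty ∈ isotropicPoints σ M)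
    (h0 : ((0 : F) : OnePoint F) ∈ isotropicPoints σ M)
    (h1 : ((1 : F) : OnePoint F) ∈ isotropicPoints σ M) :
    isotropicPoints σ M = Set.range (OnePoint.map (K₀.subtype : K₀ → F)) := by
  simp only [isotropicPoints, Set.mem_ofPred_eq, semiForm_apply, coords_infty, coords_coe,
    cons_val_zero, cons_val_one, map_one, map_zero, mul_one, mul_zero, one_mul, zero_mul,
    add_zero, zero_add] at hinf h0 h1
  rw [hinf, h0, zero_add, add_zero] at h1
  have h10 : M 1 0 = - M 0 1 := by linear_combination h1
  have h01 : M 0 1 ≠ 0 := by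
    intro h
    apply hM
    ext i j
    fin_cases i <;> fin_cases j <;> simp [hinf, h0, h10, h]
  ext x
  induction x using OnePoint.rec with
  | infty =>
    refine iff_of_true ?_ infty_mem_baseLine
    simp [isotropicPoints, semiForm_apply, hinf]
  | coe t =>
    rw [coe_mem_baseLine_iff, hK₀]
    simp only [isotropicPoints, Set.mem_ofPred_eq, semiForm_apply, coords_coe, cons_val_zero,
      cons_val_one, hinf, h0, h10, map_one]
    refine ⟨fun h => mul_left_cancel₀ h01 ?_, fun h => ?_⟩
    · linear_combination h
    · rw [h]; ring

variable [DecidableEq F]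

lemma image_smul_isotropicPoints (M : Matrix (Fin 2) (Fin 2) F) (g : GL (Fin 2) F) :
    (fun x => g • x) '' isotropicPoints σ M = isotropicPoints σ
      ((((g⁻¹ : GL (Fin 2) F) : Matrix (Fin 2) (Fin 2) F).map σ)ᵀ * M *
        ((g⁻¹ : GL (Fin 2) F) : Matrix (Fin 2) (Fin 2) F)) := by
  ext x
  rw [← smul_mem_isotropicPoints_iff]
  constructor
  · rintro ⟨y, hy, rfl⟩
    simpa using hy
  · exact fun h => ⟨g⁻¹ • x, h, by simp⟩

lemma IsSubline.exists_isotropicPoints_eq (hK₀ : ∀ x, x ∈ K₀ ↔ σ x = x) {B : Set (OnePoint F)}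
    (hB : IsSubline K₀ B) : ∃ M : Matrix (Fin 2) (Fin 2) F, M ≠ 0 ∧ B = isotropicPoints σ M := by
  obtain ⟨L, rfl⟩ := hB
  have hM : (!![0, 1; -1, 0] : Matrix (Fin 2) (Fin 2) F) ≠ 0 := by
    intro h
    simpa using congr_fun (congr_fun h 0) 1
  rw [← isotropicPoints_eq_baseLine hK₀ hM, image_smul_isotropicPoints]
  · exact ⟨_, transform_ne_zero σ hM L⁻¹, rfl⟩
  all_goals simp [isotropicPoints, semiForm_apply]

/-- Triple transitivity moves three isotropic points of a nonzero form to `∞`, `0` and `1`. -/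
lemma isotropicPoints_eq_image (hK₀ : ∀ x, x ∈ K₀ ↔ σ x = x) {M : Matrix (Fin 2) (Fin 2) F}
    (hM : M ≠ 0) {L : GL (Fin 2) F}
    (hinf : L • OnePoint.infty ∈ isotropicPoints σ M)
    (h0 : L • ((0 : F) : OnePoint F) ∈ isotropicPoints σ M)
    (h1 : L • ((1 : F) : OnePoint F) ∈ isotropicPoints σ M) :
    isotropicPoints σ M = (fun x => L • x) '' Set.range (OnePoint.map (K₀.subtype : K₀ → F)) := by
  rw [smul_mem_isotropicPoints_iff] at hinf h0 h1
  rw [← isotropicPoints_eq_baseLine hK₀ (transform_ne_zero σ hM L) hinf h0 h1]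
  ext x
  constructor
  · exact fun h => ⟨L⁻¹ • x, by
      rw [← smul_mem_isotropicPoints_iff, smul_inv_smul]; exact h, smul_inv_smul _ _⟩
  · rintro ⟨y, hy, rfl⟩
    rwa [← smul_mem_isotropicPoints_iff] at hy

lemma isSubline_isotropicPoints (hK₀ : ∀ x, x ∈ K₀ ↔ σ x = x) {M : Matrix (Fin 2) (Fin 2) F}
    (hM : M ≠ 0) [Finite F] (hcard : 2 < (isotropicPoints σ M).ncard) :
    IsSubline K₀ (isotropicPoints σ M) := by
  have : Finite (OnePoint F) := inferInstanceAs (Finite (Option F))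
  obtain ⟨x, hx, y, hy, z, hz, hxy, hxz, hyz⟩ := (Set.two_lt_ncard (Set.toFinite _)).mp hcard
  obtain ⟨L, rfl, rfl, rfl⟩ := exists_smul_eq_three hxy hxz hyz
  exact ⟨L, isotropicPoints_eq_image hK₀ hM hx hy hz⟩

lemma IsSubline.ncard_eq [Finite F] {B : Set (OnePoint F)} (hB : IsSubline K₀ B) :
    B.ncard = Nat.card K₀ + 1 := by
  obtain ⟨L, rfl⟩ := hB
  have hinj : Function.Injective (OnePoint.map (K₀.subtype : K₀ → F)) :=
    Option.map_injective K₀.subtype_injective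
  rw [Set.ncard_image_of_injective _ (MulAction.injective L), ← Set.image_univ,
    Set.ncard_image_of_injective _ hinj, Set.ncard_univ]
  exact Finite.card_option

/-- Three distinct points lie on a unique subline: by triple transitivity they are the images of
`∞`, `0`, `1`, and a nonzero form vanishing at all three is determined up to a scalar. -/
lemma existsUnique_isSubline (hK₀ : ∀ x, x ∈ K₀ ↔ σ x = x) {x y z : OnePoint F}
    (hxy : x ≠ y) (hxz : x ≠ z) (hyz : y ≠ z) :
    ∃! B : Set (OnePoint F), IsSubline K₀ B ∧ {x, y, z} ⊆ B := by
  obtain ⟨L, rfl, rfl, rfl⟩ := exists_smul_eq_three hxy hxz hyz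
  refine ⟨(fun x => L • x) '' Set.range (OnePoint.map (K₀.subtype : K₀ → F)), ⟨⟨L, rfl⟩, ?_⟩, ?_⟩
  · rintro w (rfl | rfl | rfl)
    · exact ⟨_, infty_mem_baseLine, rfl⟩
    · exact ⟨_, coe_mem_baseLine_iff.mpr K₀.zero_mem, rfl⟩
    · exact ⟨_, coe_mem_baseLine_iff.mpr K₀.one_mem, rfl⟩
  · rintro B ⟨hB, hsub⟩
    obtain ⟨M, hM, rfl⟩ := hB.exists_isotropicPoints_eq hK₀
    exact isotropicPoints_eq_image hK₀ hM (hsub (by simp)) (hsub (by simp)) (hsub (by simp))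

lemma isSteinerSystem_sublineDesign [Finite F] (hK₀ : ∀ x, x ∈ K₀ ↔ σ x = x) :
    (sublineDesign K₀).IsSteinerSystem 3 (Nat.card K₀ + 1) (Nat.card F + 1) := by
  refine ⟨Finite.card_option, fun B hB => IsSubline.ncard_eq hB, fun T hT => ?_⟩
  obtain ⟨x, y, z, hxy, hxz, hyz, rfl⟩ := Set.ncard_eq_three.mp hT
  exact existsUnique_isSubline hK₀ hxy hxz hyz

end Sublines

/-! ### The quadratic extension of a finite field -/

section FiniteFields

/-- In a field with `p ^ m` elements, the fixed field of `x ↦ x ^ (p ^ s)` is the subfield with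
`p ^ gcd m s` elements. -/
lemma mem_subfield_iff_iterateFrobenius_eq {F : Type*} [Field F] {p m : ℕ} (s : ℕ) [Fact p.Prime]
    [CharP F p] (hF : Nat.card F = p ^ m) {K₀ : Subfield F}
    (hK₀ : Nat.card K₀ = p ^ Nat.gcd m s) (x : F) :
    x ∈ K₀ ↔ iterateFrobenius F p s x = x := by
  have hp : p.Prime := Fact.out
  have : Finite F := Nat.finite_of_card_ne_zero (by rw [hF]; exact pow_ne_zero _ hp.ne_zero)
  have : Fintype F := Fintype.ofFinite F
  have : Fintype K₀ := Fintype.ofFinite K₀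
  have hper : ∀ k, Function.IsPeriodicPt (frobenius F p) k x ↔ x ^ p ^ k = x := fun k => by
    rw [Function.IsPeriodicPt, Function.IsFixedPt, iterate_frobenius]
  have hpow : ∀ y ∈ K₀, y ^ p ^ Nat.gcd m s = y := fun y hy => by
    have h := FiniteField.pow_card (⟨y, hy⟩ : K₀)
    rw [← Nat.card_eq_fintype_card, hK₀] at h
    exact congrArg Subtype.val h
  rw [iterateFrobenius_def, ← hper]
  constructor
  · intro hx
    exact ((hper _).mpr (hpow x hx)).trans_dvd (Nat.gcd_dvd_right m s)
  · intro hx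
    have hm : Function.IsPeriodicPt (frobenius F p) m x := by
      rw [hper, ← hF, Nat.card_eq_fintype_card]
      exact FiniteField.pow_card x
    have hd : x ^ p ^ Nat.gcd m s = x := (hper _).mp (hm.gcd hx)
    have hq1 : 1 < p ^ Nat.gcd m s := by
      rw [← hK₀]; exact Finite.one_lt_card
    -- the elements of `K₀` already exhaust the roots of `X ^ q₀ - X`
    have hne := FiniteField.X_pow_card_sub_X_ne_zero F hq1
    classical
    have hroot : ∀ y : F, y ∈ (Polynomial.X ^ p ^ Nat.gcd m s - Polynomial.X : F[X]).roots.toFinset ↔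
        y ^ p ^ Nat.gcd m s = y := by
      intro y
      rw [Multiset.mem_toFinset, Polynomial.mem_roots hne]
      simp [sub_eq_zero]
    have hsub : (K₀ : Set F) ⊆ {y | y ^ p ^ Nat.gcd m s = y} := hpow
    have hset : {y : F | y ^ p ^ Nat.gcd m s = y} =
        ((Polynomial.X ^ p ^ Nat.gcd m s - Polynomial.X : F[X]).roots.toFinset : Set F) := by
      ext y
      exact (hroot y).symm
    have hle : {y : F | y ^ p ^ Nat.gcd m s = y}.ncard ≤ (K₀ : Set F).ncard := by
      rw [hset, Set.ncard_coe_finset]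
      calc _ ≤ _ := Multiset.toFinset_card_le _
        _ ≤ _ := Polynomial.card_roots' _
        _ = p ^ Nat.gcd m s := FiniteField.X_pow_card_sub_X_natDegree_eq F hq1
        _ = (K₀ : Set F).ncard := hK₀.symm
    have heq := Set.eq_of_subset_of_ncard_le hsub hle (Set.toFinite _)
    have : x ∈ (K₀ : Set F) := heq ▸ hd
    exact this

variable {F E : Type*} [Field F] [Field E] [Algebra F E]

lemma X_pow_sub_one_dvd_iff {n : ℕ} (hn : 0 < n) {β : E} (hβ : IsPrimitiveRoot β n) (g : F[X]) :
    (Polynomial.X ^ n - 1 : F[X]) ∣ g ↔ ∀ ζ : E, ζ ^ n = 1 → Polynomial.aeval ζ g = 0 := by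
  constructor
  · rintro ⟨k, rfl⟩ ζ hζ
    simp [hζ]
  · intro h
    rw [← Polynomial.map_dvd_map' (algebraMap F E)]
    simp only [Polynomial.map_sub, Polynomial.map_pow, Polynomial.map_X, Polynomial.map_one]
    rw [Polynomial.X_pow_sub_one_eq_prod hn hβ]
    refine Finset.prod_dvd_of_coprime
      (fun a _ b _ hab => Polynomial.pairwise_coprime_X_sub_C Function.injective_id hab)
      fun ζ hζ => ?_
    rw [Polynomial.dvd_iff_isRoot, Polynomial.IsRoot, Polynomial.eval_map_algebraMap]
    exact h ζ ((Polynomial.mem_nthRootsFinset hn 1).mp hζ)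

variable [Finite F]

lemma algebraMap_trace_eq_add_pow (hE : Module.finrank F E = 2) (x : E) :
    algebraMap F E (Algebra.trace F E x) = x + x ^ Nat.card F := by
  have : Module.Finite F E := Module.finite_of_finrank_pos (by omega)
  have : Finite E := Module.finite_of_finite F
  rw [FiniteField.algebraMap_trace_eq_sum_pow, hE]
  simp [Finset.sum_range_succ]

lemma algebraMap_pow_natCard (x : F) : algebraMap F E x ^ Nat.card F = algebraMap F E x := by
  have : Fintype F := Fintype.ofFinite F
  rw [← map_pow, Nat.card_eq_fintype_card, FiniteField.pow_card]

lemma add_pow_natCard (x y : E) : (x + y) ^ Nat.card F = x ^ Nat.card F + y ^ Nat.card F := by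
  have : Fintype F := Fintype.ofFinite F
  rw [Nat.card_eq_fintype_card]
  exact map_add (FiniteField.frobeniusAlgHom F E) x y

/-- The conjugates of an element of the quadratic extension are itself and its Frobenius image. -/
lemma aeval_minpoly_eq_zero_iff (hE : Module.finrank F E = 2) (γ ζ : E) :
    Polynomial.aeval ζ (minpoly F γ) = 0 ↔ ζ = γ ∨ ζ = γ ^ Nat.card F := by
  have : Module.Finite F E := Module.finite_of_finrank_pos (by omega)
  have : Finite E := Module.finite_of_finite F
  have : Fintype F := Fintype.ofFinite F
  have : IsGalois F E := inferInstance
  rw [Nat.card_eq_fintype_card]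
  constructor
  · intro h
    have hc : IsConjRoot F γ ζ :=
      (isConjRoot_iff_aeval_eq_zero (Algebra.IsIntegral.isIntegral γ)).mpr h
    obtain ⟨τ, rfl⟩ := isConjRoot_iff_exists_algEquiv.mp hc.symm
    obtain ⟨⟨i, hi⟩, rfl⟩ := (FiniteField.bijective_frobeniusAlgEquivOfAlgebraic_pow F E).2 τ
    rw [hE] at hi
    interval_cases i
    · exact Or.inl rfl
    · exact Or.inr rfl
  · have h0 := minpoly.aeval F γ
    rintro (rfl | rfl)
    · exact h0
    · have := Polynomial.aeval_algHom_apply (FiniteField.frobeniusAlgHom F E) γ (minpoly F γ)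
      rw [h0, map_zero] at this
      exact this

end FiniteFields

/-! ### The trace code as a cyclic code -/

section Cyclic

variable {F E : Type*} [Field F] [Field E] [Algebra F E]

/-- The value at `ζ` of the polynomial `c_0 + c_1 X + ⋯ + c_{n-1} X ^ (n-1)` of a word. -/
noncomputable def evalWord {n : ℕ} (c : Fin n → F) (ζ : E) : E :=
  ∑ i : Fin n, algebraMap F E (c i) * ζ ^ (i : ℕ)

lemma aeval_wordPolynomial {n : ℕ} (c : Fin n → F) (ζ : E) :
    Polynomial.aeval ζ (∑ i : Fin n, Polynomial.C (c i) * Polynomial.X ^ (i : ℕ) : F[X]) =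
      evalWord c ζ := by
  simp [evalWord]

lemma sum_pow_eq_zero {n : ℕ} {r : E} (hr : r ^ n = 1) (hr1 : r ≠ 1) :
    ∑ i : Fin n, r ^ (i : ℕ) = 0 := by
  rw [Fin.sum_univ_eq_sum_range (fun i => r ^ i) n]
  refine (mul_eq_zero.mp (?_ : (1 - r) * _ = 0)).resolve_left (sub_ne_zero.mpr hr1.symm)
  rw [mul_neg_geom_sum, hr, sub_self]

/-- Orthogonality of the characters of the group of `n`-th roots of unity. -/
lemma sum_nthRootsFinset {n : ℕ} {β : E} (hβ : IsPrimitiveRoot β n) (i k : Fin n) :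
    ∑ ζ ∈ Polynomial.nthRootsFinset n (1 : E), ζ ^ (k : ℕ) * ζ⁻¹ ^ (i : ℕ) =
      if k = i then (n : E) else 0 := by
  have hn : 0 < n := i.pos
  have hβ0 : β ≠ 0 := hβ.ne_zero hn.ne'
  have hU : ∀ ζ ∈ Polynomial.nthRootsFinset n (1 : E), ζ ≠ 0 := by
    intro ζ hζ h
    rw [Polynomial.mem_nthRootsFinset hn, h, zero_pow hn.ne'] at hζ
    exact zero_ne_one hζ
  split_ifs with h
  · subst h
    rw [Finset.sum_congr rfl (g := fun _ => (1 : E))]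
    · rw [Finset.sum_const, hβ.card_nthRootsFinset, nsmul_eq_mul, mul_one]
    · intro ζ hζ
      rw [← mul_pow, mul_inv_cancel₀ (hU ζ hζ), one_pow]
  · -- multiplication by `β` permutes the roots and scales the sum by a factor other than `1`
    have hr : β ^ (k : ℕ) * β⁻¹ ^ (i : ℕ) ≠ 1 := by
      intro h1
      rw [inv_pow, mul_inv_eq_one₀ (pow_ne_zero _ hβ0)] at h1
      exact h (Fin.ext (hβ.pow_inj k.2 i.2 h1))
    set S := ∑ ζ ∈ Polynomial.nthRootsFinset n (1 : E), ζ ^ (k : ℕ) * ζ⁻¹ ^ (i : ℕ) with hS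
    have hmul : β ^ (k : ℕ) * β⁻¹ ^ (i : ℕ) * S = S := by
      rw [hS, Finset.mul_sum]
      refine Finset.sum_nbij' (fun ζ => β * ζ) (fun ζ => β⁻¹ * ζ) ?_ ?_ ?_ ?_ ?_
      · intro ζ hζ
        rw [Polynomial.mem_nthRootsFinset hn] at hζ ⊢
        rw [mul_pow, hζ, hβ.pow_eq_one, one_mul]
      · intro ζ hζ
        rw [Polynomial.mem_nthRootsFinset hn] at hζ ⊢
        rw [mul_pow, hζ, inv_pow, hβ.pow_eq_one, inv_one, one_mul]
      · intro ζ _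
        exact inv_mul_cancel_left₀ hβ0 ζ
      · intro ζ _
        exact mul_inv_cancel_left₀ hβ0 ζ
      · intro ζ _
        rw [mul_inv, mul_pow, mul_pow]
        ring
    have h0 : (β ^ (k : ℕ) * β⁻¹ ^ (i : ℕ) - 1) * S = 0 := by
      rw [sub_mul, hmul, one_mul, sub_self]
    exact (mul_eq_zero.mp h0).resolve_left (sub_ne_zero.mpr hr)

/-- Fourier inversion on the group of `n`-th roots of unity. -/
lemma sum_evalWord {n : ℕ} {β : E} (hβ : IsPrimitiveRoot β n) (c : Fin n → F) (i : Fin n) :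
    ∑ ζ ∈ Polynomial.nthRootsFinset n (1 : E), evalWord c ζ * ζ⁻¹ ^ (i : ℕ) =
      n * algebraMap F E (c i) := by
  simp only [evalWord, Finset.sum_mul, mul_assoc]
  rw [Finset.sum_comm]
  simp only [← Finset.mul_sum, sum_nthRootsFinset hβ]
  simp [mul_comm]

variable [Finite F]

lemma evalWord_pow_natCard {n : ℕ} (c : Fin n → F) (ζ : E) :
    evalWord c (ζ ^ Nat.card F) = evalWord c ζ ^ Nat.card F := by
  have : Fintype F := Fintype.ofFinite F
  have h := map_sum (FiniteField.frobeniusAlgHom F E)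
    (fun i : Fin n => algebraMap F E (c i) * ζ ^ (i : ℕ)) Finset.univ
  simp only [FiniteField.coe_frobeniusAlgHom, ← Nat.card_eq_fintype_card] at h
  simp only [evalWord]
  rw [h]
  refine Finset.sum_congr rfl fun i _ => ?_
  rw [mul_pow, algebraMap_pow_natCard, pow_right_comm]

/-- The code of all words `(Tr (a γ^{-i} + b δ^{-i}))_i` of length `q + 1`, for non-conjugate
`(q + 1)`-st roots of unity `γ` and `δ` outside `F`, consists of the words whose Fourier transform
is supported on the conjugates of `γ` and `δ`. -/
lemma exists_trace_iff_evalWord (hE : Module.finrank F E = 2) {n : ℕ} (hn : n = Nat.card F + 1)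
    {β γ δ : E} (hβ : IsPrimitiveRoot β n)
    (hγ : γ ^ n = 1) (hδ : δ ^ n = 1)
    (hγγ : γ ≠ γ ^ Nat.card F) (hδδ : δ ≠ δ ^ Nat.card F)
    (hγδ : γ ≠ δ) (hγδ' : γ ≠ δ ^ Nat.card F) (c : Fin n → F) :
    (∃ a b : E, ∀ i : Fin n,
      c i = Algebra.trace F E (a * γ⁻¹ ^ (i : ℕ) + b * δ⁻¹ ^ (i : ℕ))) ↔
    ∀ ζ : E, ζ ^ n = 1 → ζ ≠ γ → ζ ≠ γ ^ Nat.card F → ζ ≠ δ → ζ ≠ δ ^ Nat.card F →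
      evalWord c ζ = 0 := by
  classical
  have hn0 : 0 < n := by omega
  have hinv : ∀ x : E, x ^ n = 1 → x ^ Nat.card F = x⁻¹ := by
    intro x hx
    rw [hn, pow_succ] at hx
    exact eq_inv_of_mul_eq_one_left hx
  have hinvpow : ∀ x : E, x ^ n = 1 → ∀ i : ℕ, (x⁻¹ ^ i) ^ Nat.card F = x ^ i := by
    intro x hx i
    rw [pow_right_comm, inv_pow, hinv x hx, inv_inv]
  constructor
  · rintro ⟨a, b, h⟩ ζ hζ h1 h2 h3 h4
    rw [hinv γ hγ] at h2
    rw [hinv δ hδ] at h4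
    have hcoef : ∀ x : E, x ^ n = 1 → ζ ≠ x → x⁻¹ * ζ ≠ 1 := by
      intro x hx hne h
      have hx0 : x ≠ 0 := by
        rintro rfl
        simp [hn0.ne'] at hx
      exact hne (by rw [inv_mul_eq_one₀ hx0] at h; exact h.symm)
    have hzero : ∀ x : E, x ^ n = 1 → ζ ≠ x → ∑ i : Fin n, (x⁻¹ * ζ) ^ (i : ℕ) = 0 := by
      intro x hx hne
      refine sum_pow_eq_zero ?_ (hcoef x hx hne)
      rw [mul_pow, inv_pow, hx, hζ, inv_one, one_mul]
    have hi : ∀ x : E, x ^ n = 1 → x⁻¹ ^ n = 1 := fun x hx => by rw [inv_pow, hx, inv_one]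
    have hterm : ∀ i : Fin n, algebraMap F E (c i) * ζ ^ (i : ℕ) =
        a * (γ⁻¹ * ζ) ^ (i : ℕ) + b * (δ⁻¹ * ζ) ^ (i : ℕ) +
        (a ^ Nat.card F * (γ⁻¹⁻¹ * ζ) ^ (i : ℕ) + b ^ Nat.card F * (δ⁻¹⁻¹ * ζ) ^ (i : ℕ)) := by
      intro i
      rw [h, algebraMap_trace_eq_add_pow hE, add_pow_natCard, mul_pow _ _ (Nat.card F),
        mul_pow _ _ (Nat.card F), hinvpow γ hγ, hinvpow δ hδ, inv_inv, inv_inv]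
      simp only [mul_pow]
      ring
    simp only [evalWord, hterm, Finset.sum_add_distrib, ← Finset.mul_sum]
    rw [hzero γ hγ h1, hzero δ hδ h3, hzero _ (hi γ hγ) h2, hzero _ (hi δ hδ) h4]
    simp
  · intro h
    refine ⟨evalWord c γ, evalWord c δ, fun i => (algebraMap F E).injective ?_⟩
    have hsum := sum_evalWord hβ c i
    have hn1 : (n : E) = 1 := by
      have : Fintype F := Fintype.ofFinite F
      have h0 : ((Nat.card F : ℕ) : F) = 0 := by
        rw [Nat.card_eq_fintype_card]; exact FiniteField.cast_card_eq_zero F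
      have := congrArg (algebraMap F E) h0
      rw [map_natCast, map_zero] at this
      rw [hn, Nat.cast_succ, this, zero_add]
    rw [hn1, one_mul] at hsum
    have hinj : ∀ x y : E, x ^ n = 1 → y ^ n = 1 → x ^ Nat.card F = y ^ Nat.card F → x = y := by
      intro x y hx hy hxy
      rw [hinv x hx, hinv y hy] at hxy
      exact inv_injective hxy
    have hγδ'' : γ ^ Nat.card F ≠ δ := by
      intro h'
      apply hγδ'
      rw [← h', hinv _ hγ, hinv, inv_inv]
      rw [inv_pow, hγ, inv_one]
    have hpow : ∀ x : E, x ^ n = 1 → (x ^ Nat.card F) ^ n = 1 := fun x hx => by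
      rw [pow_right_comm, hx, one_pow]
    have hsub : ({γ, γ ^ Nat.card F, δ, δ ^ Nat.card F} : Finset E) ⊆
        Polynomial.nthRootsFinset n (1 : E) := by
      intro x hx
      rw [Polynomial.mem_nthRootsFinset hn0]
      simp only [Finset.mem_insert, Finset.mem_singleton] at hx
      rcases hx with rfl | rfl | rfl | rfl
      · exact hγ
      · exact hpow _ hγ
      · exact hδ
      · exact hpow _ hδ
    rw [← Finset.sum_subset hsub, Finset.sum_insert, Finset.sum_insert, Finset.sum_insert,
      Finset.sum_singleton] at hsum
    · rw [← hsum, algebraMap_trace_eq_add_pow hE, add_pow_natCard, mul_pow _ _ (Nat.card F),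
        mul_pow _ _ (Nat.card F), hinvpow γ hγ, hinvpow δ hδ, evalWord_pow_natCard,
        evalWord_pow_natCard, hinv γ hγ, hinv δ hδ, inv_inv, inv_inv]
      ring
    · simpa using hδδ
    · simp only [Finset.mem_insert, Finset.mem_singleton, not_or]
      exact ⟨hγδ'', fun h' => hγδ (hinj _ _ hγ hδ h')⟩
    · simp only [Finset.mem_insert, Finset.mem_singleton, not_or]
      exact ⟨hγγ, hγδ, hγδ'⟩
    · intro ζ hζ hζ'
      simp only [Finset.mem_insert, Finset.mem_singleton, not_or] at hζ'
      rw [h ζ ((Polynomial.mem_nthRootsFinset hn0 1).mp hζ) hζ'.1 hζ'.2.1 hζ'.2.2.1 hζ'.2.2.2,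
        zero_mul]

lemma isCyclicCodeWithCheck_minpoly_mul (hE : Module.finrank F E = 2) {n : ℕ}
    (hn : n = Nat.card F + 1) {β γ δ : E} (hβ : IsPrimitiveRoot β n)
    (hγ : γ ^ n = 1) (hδ : δ ^ n = 1)
    (hγγ : γ ≠ γ ^ Nat.card F) (hδδ : δ ≠ δ ^ Nat.card F)
    (hγδ : γ ≠ δ) (hγδ' : γ ≠ δ ^ Nat.card F) (C : Submodule F (Fin n → F))
    (hC : ∀ c, c ∈ C ↔ ∃ a b : E, ∀ i : Fin n,
      c i = Algebra.trace F E (a * γ⁻¹ ^ (i : ℕ) + b * δ⁻¹ ^ (i : ℕ))) :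
    IsCyclicCodeWithCheck C (minpoly F γ * minpoly F δ) := by
  have hn0 : 0 < n := by omega
  have : Module.Finite F E := Module.finite_of_finrank_pos (by omega)
  refine ⟨IsCoprime.mul_dvd ?_ (minpoly.dvd F γ (by simp [hγ])) (minpoly.dvd F δ (by simp [hδ])),
    fun c => ?_⟩
  · rw [(minpoly.irreducible (Algebra.IsIntegral.isIntegral γ)).coprime_iff_not_dvd]
    -- otherwise `γ` would be a conjugate of `δ`
    rintro ⟨l, hl⟩
    have h0 : Polynomial.aeval γ (minpoly F δ) = 0 := by
      rw [hl, map_mul, minpoly.aeval, zero_mul]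
    rcases (aeval_minpoly_eq_zero_iff hE δ γ).mp h0 with h1 | h1
    · exact hγδ h1
    · exact hγδ' h1
  · rw [hC, exists_trace_iff_evalWord hE hn hβ hγ hδ hγγ hδδ hγδ hγδ',
      X_pow_sub_one_dvd_iff hn0 hβ]
    refine forall_congr' fun ζ => forall_congr' fun _ => ?_
    rw [map_mul, map_mul, aeval_wordPolynomial, mul_eq_zero, mul_eq_zero,
      aeval_minpoly_eq_zero_iff hE, aeval_minpoly_eq_zero_iff hE]
    tauto

end Cyclic

/-! ### Codewords in Cayley coordinates -/

section Cayley

open Matrix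

variable {F E : Type*} [Field F] [Field E] [Algebra F E]

lemma cayley_infty (ε : E) : cayley ε (OnePoint.infty : OnePoint F) = 1 := rfl

lemma cayley_coe (ε : E) (t : F) :
    cayley ε (t : OnePoint F) = (algebraMap F E t + ε) / (algebraMap F E t - ε) := rfl

variable [Finite F]

lemma ne_algebraMap_of_pow_eq_neg (h2 : (2 : E) ≠ 0) {ε : E} (hε0 : ε ≠ 0)
    (hε : ε ^ Nat.card F = -ε) (t : F) : algebraMap F E t ≠ ε := by
  intro h
  have h1 := algebraMap_pow_natCard (E := E) t
  rw [h, hε] at h1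
  have h3 : 2 * ε = 0 := by linear_combination -h1
  exact (mul_ne_zero h2 hε0) h3

lemma algebraMap_sub_ne_zero (h2 : (2 : E) ≠ 0) {ε : E} (hε0 : ε ≠ 0)
    (hε : ε ^ Nat.card F = -ε) (t : F) : algebraMap F E t - ε ≠ 0 :=
  sub_ne_zero.mpr (ne_algebraMap_of_pow_eq_neg h2 hε0 hε t)

lemma algebraMap_add_ne_zero (h2 : (2 : E) ≠ 0) {ε : E} (hε0 : ε ≠ 0)
    (hε : ε ^ Nat.card F = -ε) (t : F) : algebraMap F E t + ε ≠ 0 := by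
  intro h
  refine ne_algebraMap_of_pow_eq_neg h2 hε0 hε (-t) ?_
  rw [map_neg]
  linear_combination -h

lemma algebraMap_add_pow {ε : E} (hε : ε ^ Nat.card F = -ε) (t : F) :
    (algebraMap F E t + ε) ^ Nat.card F = algebraMap F E t - ε := by
  rw [add_pow_natCard, algebraMap_pow_natCard, hε, sub_eq_add_neg]

lemma algebraMap_sub_pow {ε : E} (hε : ε ^ Nat.card F = -ε) (t : F) :
    (algebraMap F E t - ε) ^ Nat.card F = algebraMap F E t + ε := by
  have h : (-ε) ^ Nat.card F = ε := by
    have h0 := add_pow_natCard (F := F) ε (-ε)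
    rw [add_neg_cancel, zero_pow Nat.card_pos.ne', hε] at h0
    linear_combination -h0
  rw [sub_eq_add_neg, add_pow_natCard, algebraMap_pow_natCard, h]

lemma cayley_pow_eq_one (h2 : (2 : E) ≠ 0) {ε : E} (hε0 : ε ≠ 0) (hε : ε ^ Nat.card F = -ε)
    (x : OnePoint F) : cayley ε x ^ (Nat.card F + 1) = 1 := by
  induction x using OnePoint.rec with
  | infty => rw [cayley_infty, one_pow]
  | coe t =>
    rw [cayley_coe, div_pow, pow_succ, pow_succ, algebraMap_add_pow hε, algebraMap_sub_pow hε,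
      mul_comm, div_self]
    exact mul_ne_zero (algebraMap_add_ne_zero h2 hε0 hε t) (algebraMap_sub_ne_zero h2 hε0 hε t)

lemma cayley_injective (h2 : (2 : E) ≠ 0) {ε : E} (hε0 : ε ≠ 0) (hε : ε ^ Nat.card F = -ε) :
    Function.Injective (cayley ε : OnePoint F → E) := by
  have hne : ∀ t : F, (algebraMap F E t + ε) / (algebraMap F E t - ε) ≠ 1 := by
    intro t h
    rw [div_eq_one_iff_eq (algebraMap_sub_ne_zero h2 hε0 hε t)] at h
    exact mul_ne_zero h2 hε0 (by linear_combination h)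
  intro x y h
  induction x using OnePoint.rec with
  | infty =>
    induction y using OnePoint.rec with
    | infty => rfl
    | coe u => exact absurd h.symm (hne u)
  | coe t =>
    induction y using OnePoint.rec with
    | infty => exact absurd h (hne t)
    | coe u =>
      rw [cayley_coe, cayley_coe, div_eq_div_iff (algebraMap_sub_ne_zero h2 hε0 hε t)
        (algebraMap_sub_ne_zero h2 hε0 hε u)] at h
      have h1 : 2 * ε * (algebraMap F E u - algebraMap F E t) = 0 := by linear_combination h
      have h3 := (mul_eq_zero.mp h1).resolve_left (mul_ne_zero h2 hε0)
      rw [(algebraMap F E).injective (sub_eq_zero.mp h3)]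

/-- The Cayley map identifies `PG(1, F)` with the group of `(q + 1)`-st roots of unity, hence with
the coordinate set of the code. -/
lemma exists_equiv_cayley (h2 : (2 : E) ≠ 0) {ε : E} (hε0 : ε ≠ 0) (hε : ε ^ Nat.card F = -ε)
    {n : ℕ} (hn : n = Nat.card F + 1) {β : E} (hβ : IsPrimitiveRoot β n) :
    ∃ φ : Fin n ≃ OnePoint F, ∀ i : Fin n, cayley ε (φ i) = β⁻¹ ^ (i : ℕ) := by
  have : Finite (OnePoint F) := inferInstanceAs (Finite (Option F))
  have hcard : Nat.card (OnePoint F) = n := by rw [hn]; exact Finite.card_option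
  have : NeZero n := ⟨by omega⟩
  -- the powers of `β⁻¹` already exhaust the roots of unity
  have hex : ∀ x : OnePoint F, ∃ i : Fin n, β⁻¹ ^ (i : ℕ) = cayley ε x := by
    intro x
    obtain ⟨i, hi, h⟩ := hβ.inv.eq_pow_of_pow_eq_one
      (by rw [hn]; exact cayley_pow_eq_one h2 hε0 hε x : cayley ε x ^ n = 1)
    exact ⟨⟨i, hi⟩, h⟩
  choose g hg using hex
  have hinj : Function.Injective g := fun x y h =>
    cayley_injective h2 hε0 hε (by rw [← hg, ← hg, h])
  have hbij : Function.Bijective g :=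
    hinj.bijective_of_nat_card_le (by rw [hcard, Nat.card_fin])
  refine ⟨(Equiv.ofBijective g hbij).symm, fun i => ?_⟩
  rw [← hg]
  congr 2
  exact Equiv.ofBijective_apply_symm_apply g hbij i

/-- The sesquilinear form on `F ^ 2` which vanishes at a point `x` of `PG(1, F)` iff the codeword
with parameters `a`, `b` vanishes at the Cayley image of `x`. Here `P` is the exponent of the
Frobenius twist. -/
noncomputable def wordForm (F : Type*) {E : Type*} [Field F] [Field E] [Algebra F E]
    (ε : E) (P : ℕ) (a b : E) : Matrix (Fin 2) (Fin 2) F :=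
  !![Algebra.trace F E (a + b), Algebra.trace F E (ε * (b - a));
    Algebra.trace F E (ε ^ P * (a + b)), Algebra.trace F E (ε ^ (P + 1) * (b - a))]

/-- Every `2 × 2` matrix over `F` is the form of some word: `1` and `ε` are a basis of `E` over `F`,
orthogonal for the trace form, and `ε ^ 2` lies in `F`. -/
lemma exists_wordForm_eq (hE : Module.finrank F E = 2) (h2 : (2 : E) ≠ 0) {ε : E}
    (hε0 : ε ≠ 0) (hε : ε ^ Nat.card F = -ε) (e : ℕ) (M : Matrix (Fin 2) (Fin 2) F) :
    ∃ a b : E, wordForm F ε (2 * e + 1) a b = M := by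
  have h2F : (2 : F) ≠ 0 := fun h => h2 (by
    rw [← map_ofNat (algebraMap F E) 2, h, map_zero])
  have htr : ∀ k l : F,
      Algebra.trace F E (algebraMap F E k + algebraMap F E l * ε) = 2 * k := by
    intro k l
    apply (algebraMap F E).injective
    rw [algebraMap_trace_eq_add_pow hE, add_pow_natCard, mul_pow, algebraMap_pow_natCard,
      algebraMap_pow_natCard, hε, map_mul, map_ofNat]
    ring
  obtain ⟨η, hη⟩ : ∃ η : F, algebraMap F E η = ε ^ 2 := by
    refine ⟨Algebra.trace F E (ε ^ 2) / 2, ?_⟩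
    rw [map_div₀, algebraMap_trace_eq_add_pow hE, pow_right_comm, hε, map_ofNat, neg_sq, ← two_mul,
      mul_div_cancel_left₀ _ h2]
  have hη0 : η ≠ 0 := by
    rintro rfl
    rw [map_zero] at hη
    exact pow_ne_zero 2 hε0 hη.symm
  -- `g` and `h` are to be the sum and the difference of the parameters
  set g : E := algebraMap F E (M 0 0 / 2) + algebraMap F E (M 1 0 / (2 * η ^ (e + 1))) * ε with hg
  set h : E := algebraMap F E (M 1 1 / (2 * η ^ (e + 1))) + algebraMap F E (M 0 1 / (2 * η)) * ε
    with hh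
  refine ⟨(g - h) / 2, (g + h) / 2, ?_⟩
  have hsum : (g - h) / 2 + (g + h) / 2 = g := by field_simp; ring
  have hdiff : (g + h) / 2 - (g - h) / 2 = h := by field_simp; ring
  have hpow : ε ^ (2 * e + 1) = algebraMap F E (η ^ e) * ε := by
    rw [map_pow, hη, pow_succ, pow_mul]
  have hpow' : ε ^ (2 * e + 1 + 1) = algebraMap F E (η ^ (e + 1)) := by
    rw [map_pow, hη, ← pow_mul]; congr 1
  have e00 : Algebra.trace F E g = M 0 0 := by
    rw [hg, htr]; field_simp
  have e01 : Algebra.trace F E (ε * h) = M 0 1 := by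
    have : ε * h = algebraMap F E (M 0 1 / (2 * η) * η) +
        algebraMap F E (M 1 1 / (2 * η ^ (e + 1))) * ε := by
      rw [hh, map_mul, hη]; ring
    rw [this, htr]; field_simp
  have e10 : Algebra.trace F E (ε ^ (2 * e + 1) * g) = M 1 0 := by
    have : ε ^ (2 * e + 1) * g = algebraMap F E (M 1 0 / (2 * η ^ (e + 1)) * η ^ e * η) +
        algebraMap F E (η ^ e * (M 0 0 / 2)) * ε := by
      rw [hpow, hg]; simp only [map_mul]; rw [hη]; ring
    rw [this, htr]; field_simp; ring
  have e11 : Algebra.trace F E (ε ^ (2 * e + 1 + 1) * h) = M 1 1 := by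
    have : ε ^ (2 * e + 1 + 1) * h = algebraMap F E (η ^ (e + 1) * (M 1 1 / (2 * η ^ (e + 1)))) +
        algebraMap F E (η ^ (e + 1) * (M 0 1 / (2 * η))) * ε := by
      rw [hpow', hh]; simp only [map_mul]; ring
    rw [this, htr]; field_simp
  rw [wordForm, hsum, hdiff, e00, e01, e10, e11]
  exact (eta_fin_two M).symm

variable {p : ℕ} [Fact p.Prime] [CharP F p] [CharP E p]

/-- Clearing denominators in the codeword with parameters `a`, `b` at the Cayley image of a finite
point `t` multiplies it by a power of `t ^ 2 - ε ^ 2`, a nonzero element of `F`. -/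
lemma algebraMap_semiForm_wordForm_coe (hE : Module.finrank F E = 2) (h2 : (2 : E) ≠ 0) {ε : E}
    (hε0 : ε ≠ 0) (hε : ε ^ Nat.card F = -ε) {s e : ℕ} (hP : p ^ s = 2 * e + 1) (a b : E) (t : F) :
    algebraMap F E (semiForm (iterateFrobenius F p s) (wordForm F ε (p ^ s) a b)
      (coords (t : OnePoint F))) =
    ((algebraMap F E t + ε) * (algebraMap F E t - ε)) ^ (e + 1) *
      algebraMap F E (Algebra.trace F E
        (a * cayley ε (t : OnePoint F) ^ e + b * cayley ε (t : OnePoint F) ^ (e + 1))) := by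
  set T := algebraMap F E t with hT
  have hy : T - ε ≠ 0 := algebraMap_sub_ne_zero h2 hε0 hε t
  have hNorm : ((T + ε) * (T - ε)) ^ Nat.card F = (T + ε) * (T - ε) := by
    rw [mul_pow, algebraMap_add_pow hε, algebraMap_sub_pow hε, mul_comm]
  have hlin : semiForm (iterateFrobenius F p s) (wordForm F ε (p ^ s) a b)
      (coords (t : OnePoint F)) = Algebra.trace F E
        (b * (T + ε) ^ (p ^ s + 1) + a * ((T + ε) ^ p ^ s * (T - ε))) := by
    have hexp : b * (T + ε) ^ (p ^ s + 1) + a * ((T + ε) ^ p ^ s * (T - ε)) =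
        (t ^ p ^ s * t) • (a + b) + t ^ p ^ s • (ε * (b - a)) + t • (ε ^ p ^ s * (a + b)) +
          ε ^ (p ^ s + 1) * (b - a) := by
      rw [pow_succ (T + ε), add_pow_char_pow]
      simp only [Algebra.smul_def, map_mul, map_pow, ← hT]
      ring
    rw [hexp]
    simp only [map_add, map_smul, smul_eq_mul, semiForm_apply, wordForm, coords_coe,
      iterateFrobenius_def, cons_val_zero, cons_val_one, of_apply, map_one]
    ring
  have hfac : b * (T + ε) ^ (p ^ s + 1) + a * ((T + ε) ^ p ^ s * (T - ε)) =
      ((T + ε) * (T - ε)) ^ (e + 1) *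
        (a * cayley ε (t : OnePoint F) ^ e + b * cayley ε (t : OnePoint F) ^ (e + 1)) := by
    rw [cayley_coe, hP, ← hT]
    have h1 : ∀ k, ((T + ε) / (T - ε)) ^ k * (T - ε) ^ k = (T + ε) ^ k := fun k => by
      rw [← mul_pow, div_mul_cancel₀ _ hy]
    rw [mul_pow, mul_add]
    have ha := h1 e
    have hb := h1 (e + 1)
    linear_combination (-(a * (T + ε) ^ (e + 1) * (T - ε))) * ha -
      (b * (T + ε) ^ (e + 1)) * hb
  rw [hlin, hfac, algebraMap_trace_eq_add_pow hE, algebraMap_trace_eq_add_pow hE,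
    mul_pow _ _ (Nat.card F), pow_right_comm, hNorm]
  ring

lemma trace_eq_zero_iff_mem_isotropicPoints (hE : Module.finrank F E = 2) (h2 : (2 : E) ≠ 0)
    {ε : E} (hε0 : ε ≠ 0) (hε : ε ^ Nat.card F = -ε) {s e : ℕ} (hP : p ^ s = 2 * e + 1) (a b : E)
    (x : OnePoint F) :
    Algebra.trace F E (a * cayley ε x ^ e + b * cayley ε x ^ (e + 1)) = 0 ↔
      x ∈ isotropicPoints (iterateFrobenius F p s) (wordForm F ε (p ^ s) a b) := by
  induction x using OnePoint.rec with
  | infty =>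
    simp [isotropicPoints, semiForm_apply, wordForm, cayley_infty]
  | coe t =>
    rw [isotropicPoints, Set.mem_ofPred_eq, ← map_eq_zero_iff (algebraMap F E)
        (algebraMap F E).injective (x := semiForm _ _ _),
      algebraMap_semiForm_wordForm_coe hE h2 hε0 hε hP, mul_eq_zero,
      map_eq_zero_iff (algebraMap F E) (algebraMap F E).injective]
    exact (or_iff_right (pow_ne_zero _ (mul_ne_zero (algebraMap_add_ne_zero h2 hε0 hε t)
      (algebraMap_sub_ne_zero h2 hε0 hε t)))).symm

end Cayley

/-! ### Minimum-weight words -/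

section MinimumWeight

variable {F : Type*} [Field F] [DecidableEq F] {n : ℕ}

lemma hammingNorm_add_ncard_zeros (c : Fin n → F) :
    hammingNorm c + {i | c i = 0}.ncard = n := by
  classical
  have h : {i | c i = 0} = ((Finset.univ.filter fun i => c i = 0 : Finset (Fin n)) : Set (Fin n)) := by
    ext i; simp
  rw [h, Set.ncard_coe_finset, hammingNorm, add_comm, Finset.card_filter_add_card_filter_not,
    Finset.card_univ, Fintype.card_fin]

variable [Finite F] {σ : F →+* F} {K₀ : Subfield F} {C : Submodule F (Fin n → F)}
  {φ : Fin n ≃ OnePoint F}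

/-- Suppose the zero sets of the words of a code are, under an identification of the coordinates
with `PG(1, F)`, the sets of isotropic points of `σ`-sesquilinear forms, all forms occurring. Two
isotropic points are fewer than a subline has, so the words with the most zeros are those whose zero
sets are sublines. -/
lemma minWeight_and_isSubline_iff (hK₀ : ∀ x, x ∈ K₀ ↔ σ x = x)
    (hK₀F : Nat.card K₀ < Nat.card F) (hn : n = Nat.card F + 1)
    (hC : ∀ c ∈ C, ∃ M : Matrix (Fin 2) (Fin 2) F,
      ∀ i, c i = 0 ↔ φ i ∈ isotropicPoints σ M)
    (hC' : ∀ M : Matrix (Fin 2) (Fin 2) F, ∃ c ∈ C,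
      ∀ i, c i = 0 ↔ φ i ∈ isotropicPoints σ M) :
    minWeight C = Nat.card F - Nat.card K₀ ∧
      ∀ B : Set (OnePoint F), IsSubline K₀ B ↔ ∃ c, IsMinWord C c ∧ B = φ '' {i | c i = 0} := by
  have hzero : ∀ (c : Fin n → F) (Z : Set (OnePoint F)), (∀ i, c i = 0 ↔ φ i ∈ Z) →
      φ '' {i | c i = 0} = Z := by
    intro c Z h
    ext x
    constructor
    · rintro ⟨i, hi, rfl⟩
      exact (h i).mp hi
    · exact fun hx => ⟨φ.symm x, (h _).mpr (by simpa using hx), by simp⟩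
  have hweight : ∀ c : Fin n → F, hammingNorm c + (φ '' {i | c i = 0}).ncard = Nat.card F + 1 := by
    intro c
    rw [Set.ncard_image_of_injective _ φ.injective, hammingNorm_add_ncard_zeros, hn]
  have hK₀2 : 1 < Nat.card K₀ := Finite.one_lt_card
  -- a nonzero word has at most `|K₀| + 1` zeros, with equality only for sublines
  have hub : ∀ c ∈ C, c ≠ 0 → IsSubline K₀ (φ '' {i | c i = 0}) ∨
      (φ '' {i | c i = 0}).ncard ≤ 2 := by
    intro c hc hc0
    obtain ⟨M, hM⟩ := hC c hc
    rw [hzero c _ hM]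
    have hM0 : M ≠ 0 := by
      rintro rfl
      apply hc0
      ext i
      exact (hM i).mpr (by simp [isotropicPoints, semiForm_apply])
    by_cases h : 2 < (isotropicPoints σ M).ncard
    · exact Or.inl (isSubline_isotropicPoints hK₀ hM0 h)
    · exact Or.inr (not_lt.mp h)
  have hex : ∀ B : Set (OnePoint F), IsSubline K₀ B → ∃ c ∈ C, c ≠ 0 ∧
      hammingNorm c = Nat.card F - Nat.card K₀ ∧ B = φ '' {i | c i = 0} := by
    intro B hB
    obtain ⟨M, hM, rfl⟩ := hB.exists_isotropicPoints_eq hK₀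
    obtain ⟨c, hc, h⟩ := hC' M
    have hz := hzero c _ h
    have hw := hweight c
    rw [hz, hB.ncard_eq] at hw
    refine ⟨c, hc, ?_, by omega, hz.symm⟩
    rw [← hammingNorm_pos_iff]
    omega
  have hmin : minWeight C = Nat.card F - Nat.card K₀ := by
    refine IsLeast.csInf_eq ⟨?_, ?_⟩
    · obtain ⟨c, hc, hc0, hw, -⟩ := hex _ ⟨1, rfl⟩
      exact ⟨c, hc, hc0, hw⟩
    · rintro w ⟨c, hc, hc0, rfl⟩
      have hw := hweight c
      rcases hub c hc hc0 with h | h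
      · rw [h.ncard_eq] at hw
        omega
      · omega
  refine ⟨hmin, fun B => ⟨fun hB => ?_, ?_⟩⟩
  · obtain ⟨c, hc, hc0, hw, hB'⟩ := hex B hB
    exact ⟨c, ⟨hc, hc0, hw.trans hmin.symm⟩, hB'⟩
  · rintro ⟨c, ⟨hc, hc0, hw⟩, rfl⟩
    refine (hub c hc hc0).resolve_right fun h => ?_
    have hw' := hweight c
    rw [hw, hmin] at hw'
    -- this is where `|K₀| + 1 > 2` matters
    omega

end MinimumWeight

end CyclicSubline

/-! ### The minimum-weight words and the sublines -/

theorem mainTheorem1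
    {F E : Type*} [Field F] [DecidableEq F] [Field E] [Algebra F E]
    (p m s q q₀ : ℕ) (hp : p.Prime) (hp2 : p ≠ 2) (hs : 1 ≤ s) (hsm : s < m)
    (hq : q = p ^ m) (hq₀ : q₀ = p ^ Nat.gcd m s)
    -- `F` is the field with `q` elements, `E` the field with `q ^ 2` elements
    (hF : Nat.card F = q) (hE : Module.finrank F E = 2)
    -- `K₀` is the subfield of `F` with `q₀` elements
    (K₀ : Subfield F) (hK₀ : Nat.card K₀ = q₀)
    (β : E) (hβ : orderOf β = q + 1)
    (ε : E) (hε0 : ε ≠ 0) (hε : ε ^ q = -ε)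
    (C : Submodule F (Fin (q + 1) → F))
    (hC : C = CyclicSubline.traceCode F (q + 1) β ((p ^ s - 1) / 2) ((p ^ s + 1) / 2)) :
    -- `C` is the cyclic code whose check polynomial is the product of the minimal polynomials
    CyclicSubline.IsCyclicCodeWithCheck C
      (minpoly F (β ^ ((p ^ s - 1) / 2)) * minpoly F (β ^ ((p ^ s + 1) / 2))) ∧
    CyclicSubline.minWeight C = q - q₀ ∧
    -- the zero sets of the minimum-weight words are the Cayley images of the sublines
    {Z : Set E | ∃ c, CyclicSubline.IsMinWord C c ∧ Z = CyclicSubline.zeroSet β c} =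
      {Z : Set E | ∃ B : Set (OnePoint F), CyclicSubline.IsSubline K₀ B ∧
        Z = CyclicSubline.cayley ε '' B} ∧
    -- the sublines form a Steiner system `S(3, q₀ + 1, q + 1)`
    (CyclicSubline.sublineDesign K₀).IsSteinerSystem 3 (q₀ + 1) (q + 1) ∧
    -- the minimum-support design is its complement, via the Cayley identification of points
    ∃ φ : Fin (q + 1) ≃ OnePoint F,
      (∀ i : Fin (q + 1), CyclicSubline.cayley ε (φ i) = β⁻¹ ^ (i : ℕ)) ∧
      (CyclicSubline.minSupportDesign C).IsIso
        (CyclicSubline.sublineDesign K₀).complement φ := by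
  have : Fact p.Prime := ⟨hp⟩
  have hFq : Nat.card F = p ^ m := hF.trans hq
  have : Finite F := Nat.finite_of_card_ne_zero (by rw [hFq]; exact pow_ne_zero _ hp.ne_zero)
  have : Module.Finite F E := Module.finite_of_finrank_pos (by omega)
  have : Fintype F := Fintype.ofFinite F
  have : CharP F p := charP_of_card_eq_prime_pow (by rw [← Nat.card_eq_fintype_card, hFq])
  have : CharP E p := charP_of_injective_algebraMap (algebraMap F E).injective p
  have h2 : (2 : E) ≠ 0 := Ring.two_ne_zero (by rw [ringChar.eq E p]; exact hp2)
  have hodd : Odd (p ^ s) := (hp.odd_of_ne_two hp2).pow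
  obtain ⟨e, he⟩ := hodd
  have hdiv : (p ^ s - 1) / 2 = e := by omega
  have hdiv' : (p ^ s + 1) / 2 = e + 1 := by omega
  have he0 : 1 < p ^ s := Nat.one_lt_pow (by omega) hp.one_lt
  have hlt : p ^ s < p ^ m := Nat.pow_lt_pow_right hp.one_lt hsm
  rw [hdiv, hdiv'] at hC ⊢
  subst hF
  have hβ' : IsPrimitiveRoot β (Nat.card F + 1) := hβ ▸ IsPrimitiveRoot.orderOf β
  have hmem : ∀ c, c ∈ C ↔ ∃ a b : E, ∀ i : Fin (Nat.card F + 1),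
      c i = Algebra.trace F E (a * (β⁻¹ ^ (i : ℕ)) ^ e + b * (β⁻¹ ^ (i : ℕ)) ^ (e + 1)) := by
    intro c
    rw [hC, CyclicSubline.mem_traceCode]
    simp only [← pow_mul, mul_comm]
  have hfix := CyclicSubline.mem_subfield_iff_iterateFrobenius_eq s hFq (K₀ := K₀)
    (hK₀.trans hq₀)
  have hK₀F : Nat.card K₀ < Nat.card F := by
    rw [hK₀, hq₀, hFq]
    exact Nat.pow_lt_pow_right hp.one_lt ((Nat.gcd_le_right _ hs).trans_lt hsm)
  obtain ⟨φ, hφ⟩ := CyclicSubline.exists_equiv_cayley h2 hε0 hε rfl hβ'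
  have hzeros : ∀ (a b : E) (i : Fin (Nat.card F + 1)),
      Algebra.trace F E (a * (β⁻¹ ^ (i : ℕ)) ^ e + b * (β⁻¹ ^ (i : ℕ)) ^ (e + 1)) = 0 ↔
        φ i ∈ CyclicSubline.isotropicPoints (iterateFrobenius F p s)
          (CyclicSubline.wordForm F ε (p ^ s) a b) := by
    intro a b i
    rw [← hφ]
    exact CyclicSubline.trace_eq_zero_iff_mem_isotropicPoints hE h2 hε0 hε he a b (φ i)
  obtain ⟨hmin, hsub⟩ := CyclicSubline.minWeight_and_isSubline_iff (C := C) (φ := φ) hfix hK₀F rfl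
    (by
      intro c hc
      obtain ⟨a, b, h⟩ := (hmem c).mp hc
      exact ⟨_, fun i => by rw [h]; exact hzeros a b i⟩)
    (by
      intro M
      obtain ⟨a, b, rfl⟩ := CyclicSubline.exists_wordForm_eq hE h2 hε0 hε e M
      rw [← he]
      exact ⟨_, (hmem _).mpr ⟨a, b, fun i => rfl⟩, hzeros a b⟩)
  have hpowne : ∀ k, 0 < k → k < Nat.card F + 1 → β ^ k ≠ 1 := fun k h0 hk =>
    hβ'.pow_ne_one_of_pos_of_lt h0.ne' hk
  have hroot : ∀ k, (β ^ k) ^ (Nat.card F + 1) = 1 := fun k => by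
    rw [pow_right_comm, hβ'.pow_eq_one, one_pow]
  -- two roots of unity are conjugate only if they are equal or their product is `1`
  have hconj : ∀ j k, 0 < j + k → j + k < Nat.card F + 1 → β ^ j ≠ (β ^ k) ^ Nat.card F := by
    intro j k h0 hk h
    refine hpowne (j + k) h0 hk ?_
    rw [pow_add, h, ← pow_succ, hroot]
  refine ⟨?_, ?_, ?_, ?_, φ, hφ, ?_⟩
  · refine CyclicSubline.isCyclicCodeWithCheck_minpoly_mul hE rfl hβ' (hroot _) (hroot _)
      (hconj _ _ (by omega) (by omega)) (hconj _ _ (by omega) (by omega)) ?_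
      (hconj _ _ (by omega) (by omega)) C ?_
    · intro h
      have := hβ'.pow_inj (by omega) (by omega) h
      omega
    · intro c
      rw [hmem]
      simp only [← inv_pow, pow_right_comm]
  · rw [hmin, hK₀]
  · have hZ : ∀ c : Fin (Nat.card F + 1) → F, CyclicSubline.zeroSet β c =
        CyclicSubline.cayley ε '' (φ '' {i | c i = 0}) := by
      intro c
      ext u
      simp only [CyclicSubline.zeroSet, Set.image_image, hφ]
      constructor
      · rintro ⟨i, rfl, hi⟩
        exact ⟨i, hi, rfl⟩
      · rintro ⟨i, hi, rfl⟩
        exact ⟨i, rfl, hi⟩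
    ext Z
    constructor
    · rintro ⟨c, hc, rfl⟩
      exact ⟨_, (hsub _).mpr ⟨c, hc, rfl⟩, hZ c⟩
    · rintro ⟨B, hB, rfl⟩
      obtain ⟨c, hc, rfl⟩ := (hsub B).mp hB
      exact ⟨c, hc, (hZ c).symm⟩
  · rw [← hK₀]
    exact CyclicSubline.isSteinerSystem_sublineDesign hfix
  · have hS : ∀ c : Fin (Nat.card F + 1) → F,
        φ '' Function.support c = (φ '' {i | c i = 0})ᶜ := by
      intro c
      rw [← Set.image_compl_eq φ.bijective]
      rfl
    intro S
    constructor
    · rintro ⟨c, hc, rfl⟩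
      exact ⟨_, (hsub _).mpr ⟨c, hc, rfl⟩, hS c⟩
    · rintro ⟨B, hB, h⟩
      obtain ⟨c, hc, rfl⟩ := (hsub B).mp hB
      exact ⟨c, hc, φ.injective.image_injective (h.trans (hS c).symm)⟩
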